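/- For an integer $z$ let $$f_z(X)=X^4-zX^3-\frac{3z^6-16z^4+37z^2-32}{8}X^2-\frac{2z^9-19z^7+72z^5-135z^3+96z}{16}X-\frac{3z^{12}-40z^{10}+214z^8-576z^6+719z^4-64z^2-512}{256}\in\mathbb{Q}[X].$$ We say that $z$ satisfies condition (S) if $z^2-2$ is squarefree and, in addition, $(z^4-4z^2+8)/4$ is squarefree when $z$ is even, and $z^4-4z^2+8$ is squarefree when $z$ is odd. A number field $K$ of degree $n$ is called monogenic if there is $\theta\in K$ such that $\{1,\theta,\dots,\theta^{n-1}\}$ is a $\mathbb{Z}$-basis of its ring of integers $\mathcal{O}_K$. Let $z\in\mathbb{Z}$. (a) The polynomial $f_z(X)$ is irreducible over $\mathbb{Q}$ with Galois group $C_4$, and if $|z|\ge 2$ all its complex roots are real. If $z$ satisfies (S), then $\mathbb{Q}(\vartheta)$ is a monogenic field for every root $\vartheta\in\mathbb{C}$ of $f_z(X)$. (b) If $z\not\equiv 2\pmod 4$, then $f_z(X)\in\mathbb{Z}[X]$. If moreover $z$ satisfies (S), then for every root $\vartheta\in\mathbb{C}$ of $f_z(X)$ the set $\{1,\vartheta,\vartheta^2,\vartheta^3\}$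 is a $\mathbb{Z}$-basis of $\mathcal{O}_{\mathbb{Q}(\vartheta)}$. (c) If $z\equiv 2\pmod 4$, then $f_z(X-1/2)\in\mathbb{Z}[X]$, and for every root $\vartheta\in\mathbb{C}$ of $f_z(X)$ the number $\vartheta_1=\vartheta+1/2$ is a root of $f_z(X-1/2)$. If moreover $z$ satisfies (S), then $\{1,\vartheta_1,\vartheta_1^2,\vartheta_1^3\}$ is a $\mathbb{Z}$-basis of $\mathcal{O}_{\mathbb{Q}(\vartheta_1)}$. -/

import Mathlib

open Polynomial IntermediateField

/-- The quartic polynomial `f_z(X)` with rational coefficients, for an integer `z`. -/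
noncomputable def quarticF (z : ℤ) : ℚ[X] :=
  X ^ 4 - C (z : ℚ) * X ^ 3
    - C ((3 * (z : ℚ) ^ 6 - 16 * (z : ℚ) ^ 4 + 37 * (z : ℚ) ^ 2 - 32) / 8) * X ^ 2
    - C ((2 * (z : ℚ) ^ 9 - 19 * (z : ℚ) ^ 7 + 72 * (z : ℚ) ^ 5 - 135 * (z : ℚ) ^ 3
        + 96 * (z : ℚ)) / 16) * X
    - C ((3 * (z : ℚ) ^ 12 - 40 * (z : ℚ) ^ 10 + 214 * (z : ℚ) ^ 8 - 576 * (z : ℚ) ^ 6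
        + 719 * (z : ℚ) ^ 4 - 64 * (z : ℚ) ^ 2 - 512) / 256)

/-- A rational polynomial has integer coefficients. -/
def HasIntegerCoeffs (p : ℚ[X]) : Prop :=
  ∃ q : ℤ[X], q.map (Int.castRingHom ℚ) = p

/-- `1, θ, ..., θ ^ (n - 1)` is a `ℤ`-basis of the ring of integers of `K`. -/
def IsPowerIntegralBasis (K : Type*) [Field K] (n : ℕ) (θ : K) : Prop :=
  ∃ b : Module.Basis (Fin n) ℤ (NumberField.RingOfIntegers K),
    ∀ i : Fin n, ((b i : NumberField.RingOfIntegers K) : K) = θ ^ (i : ℕ)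

/-- A monogenic field: a number field whose ring of integers has a `ℤ`-basis
consisting of the powers `1, θ, ..., θ ^ (n - 1)`, where `n` is the degree of the field. -/
def IsMonogenicField (K : Type*) [Field K] [CharZero K] : Prop :=
  NumberField K ∧ ∃ θ : K, IsPowerIntegralBasis K (Module.finrank ℚ K) θ

/-- The squarefreeness conditions on the integer `z`. (For even `z` the division by `4`
is exact.) -/
def SquarefreeConditions (z : ℤ) : Prop :=
  Squarefree (z ^ 2 - 2) ∧
    (Even z → Squarefree ((z ^ 4 - 4 * z ^ 2 + 8) / 4)) ∧
    (Odd z → Squarefree (z ^ 4 - 4 * z ^ 2 + 8))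

/-!
Put `m = z ^ 2 - 2` and `d = m ^ 2 + 4 = z ^ 4 - 4 z ^ 2 + 8`. The roots of `f_z` live over the
quadratic field generated by the unit `ω` with `ω ^ 2 = m ω + 1`. With `w = 2 ω - m = ±√d`, a root
is `θ = (z (1 + w) / 2 + η) / 2` where `η ^ 2 = m w ω` (`QuarticData`), and conversely `ω` is an
explicit polynomial in `θ` (`quadUnit`). Since `d` is not a square and the norm `m ^ 2 d` of
`η ^ 2` is not a square, `1, ω, η, ω η` are linearly independent over `ℚ`, so `f_z` is the minimal
polynomial of `θ`. The map `ω ↦ -1 / ω`, `η ↦ η / ω` permutes the roots, and its square sends `η` to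
`-η`; it generates a cyclic Galois group of order `4` (`isCyclic_algEquiv`). If `|z| ≥ 2` then
`m > 0`, `ω` is real, and `η ^ 2 = m (ω ^ 2 + 1) > 0`, so the roots are real.

For the rings of integers, write an algebraic integer as `α = x + y θ` with `x, y ∈ ℚ(ω)`. The
difference of `α` and its relative conjugate is `y η`, so `y ^ 2 m w` is integral. Under the
squarefreeness conditions, comparing trace and norm bounds the denominators of `y`:

* for odd `z`, `y` lies in `ℤ[ω]`, hence `x` does, and `ω ∈ ℤ[θ]` gives `α ∈ ℤ[θ]`
  (`QuarticData.mem_adjoin_of_odd`);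
* for even `z`, only `4 y` is obtained in `ℤ[ω]`, and `ω ∈ ℤ[φ]` for `φ = θ - z / 4`, so
  `4 α ∈ ℤ[φ]`. The minimal polynomial of `φ` is Eisenstein at `2`
  (`evenQuartic_isEisensteinAt`), which forces `α ∈ ℤ[φ]` (`QuarticData.mem_adjoin_of_even`).
  Both `θ` for `4 ∣ z` and `θ + 1 / 2` for `z ≡ 2` modulo `4` differ from `φ` by an integer.
-/

/-! ### Coordinates for the roots of the quartic -/

/-- The coordinates in which `f_z` becomes transparent. With `m = z ^ 2 - 2`, `ω` is a root of
`X ^ 2 - m X - 1`, so `w = 2 ω - m` satisfies `w ^ 2 = d` with `d = m ^ 2 + 4`; further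
`η ^ 2 = m w ω`, and `θ = (z (1 + w) / 2 + η) / 2`. Over a field containing `ℚ`, some `ω, η` with
these properties exist exactly when `θ` is a root of `f_z`. -/
structure QuarticData {K : Type*} [Field K] (z : ℤ) (θ ω η : K) : Prop where
  sq_omega : ω ^ 2 = ((z : K) ^ 2 - 2) * ω + 1
  sq_eta : η ^ 2 = ((z : K) ^ 2 - 2) * (2 * ω - ((z : K) ^ 2 - 2)) * ω
  four_theta : 4 * θ = z * (1 + (2 * ω - ((z : K) ^ 2 - 2))) + 2 * η

/-- The polynomial expression in a root `θ` of `f_z` that yields `ω`, written in powers of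
`θ - z / 4`. -/
def quadUnit {K : Type*} [Field K] (z : ℤ) (θ : K) : K :=
  -z * (θ - z / 4) ^ 3 + ((z : K) ^ 2 - 2) ^ 2 / 4 * (θ - z / 4) ^ 2
    + z * (((z : K) ^ 2 - 2) ^ 2 + 4) * (5 * z ^ 2 - 4) / 16 * (θ - z / 4)
    + ((z : K) ^ 2 - 2) ^ 2 * (((z : K) ^ 2 - 2) ^ 2 + 4) * (3 * z ^ 2 + 4) / 64
    + ((z : K) ^ 2 - 2) / 2

section
variable {K : Type*} [Field K] [Algebra ℚ K] {z : ℤ} {θ ω η : K}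

/-- `f_z` as a depressed quartic, in the variable `θ - z / 4`. -/
theorem aeval_quarticF (z : ℤ) (θ : K) : aeval θ (quarticF z) =
    (θ - z / 4) ^ 4
    - (3 * (z : K) ^ 2 - 4) * (((z : K) ^ 2 - 2) ^ 2 + 4) / 8 * (θ - z / 4) ^ 2
    - z * ((z : K) ^ 2 - 2) ^ 2 * (((z : K) ^ 2 - 2) ^ 2 + 4) / 8 * (θ - z / 4)
    + ((((z : K) ^ 2 - 2) ^ 2 + 4) ^ 2 * (4 - z ^ 2) ^ 2 / 256
      - (((z : K) ^ 2 - 2) ^ 2 + 4) * ((z : K) ^ 2 - 2) ^ 4 / 64) := by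
  have : CharZero K := algebraRat.charZero K
  simp only [quarticF, map_sub, map_mul, map_add, map_pow, aeval_X, aeval_C, map_div₀, map_intCast,
    map_ofNat]
  field_simp
  ring

theorem quadUnit_sq (h : aeval θ (quarticF z) = 0) :
    quadUnit z θ ^ 2 = ((z : K) ^ 2 - 2) * quadUnit z θ + 1 := by
  have : CharZero K := algebraRat.charZero K
  rw [aeval_quarticF] at h
  rw [quadUnit]
  generalize θ - z / 4 = Y at *
  generalize (z : K) = t at *
  -- The difference has degree `6` in `Y`; the factor is its quotient by the depressed quartic.
  linear_combination (t ^ 2 * Y ^ 2 - t * (t ^ 2 - 2) ^ 2 / 2 * Y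
    + ((t ^ 2 - 2) ^ 4 / 16 - t ^ 2 * ((t ^ 2 - 2) ^ 2 + 4) * (5 * t ^ 2 - 4) / 8
      + t ^ 2 * (3 * t ^ 2 - 4) * ((t ^ 2 - 2) ^ 2 + 4) / 8)) * h

theorem QuarticData.of_root (h : aeval θ (quarticF z) = 0) :
    QuarticData z θ (quadUnit z θ)
      (2 * θ - z * (1 + (2 * quadUnit z θ - ((z : K) ^ 2 - 2))) / 2) := by
  have : CharZero K := algebraRat.charZero K
  have hsq := quadUnit_sq h
  refine ⟨hsq, ?_, by field_simp; ring⟩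
  rw [aeval_quarticF] at h
  obtain ⟨Y, rfl⟩ : ∃ Y, θ = Y + z / 4 := ⟨θ - z / 4, by ring⟩
  simp only [quadUnit, add_sub_cancel_right] at h hsq ⊢
  generalize (z : K) = t at *
  linear_combination 4 * t ^ 2 * h + (t ^ 2 - 2 * (t ^ 2 - 2)) * hsq

theorem QuarticData.root (h : QuarticData z θ ω η) : aeval θ (quarticF z) = 0 := by
  have : CharZero K := algebraRat.charZero K
  obtain ⟨h1, h2, h3⟩ := h
  rw [aeval_quarticF]
  obtain rfl : θ = (z * (1 + (2 * ω - ((z : K) ^ 2 - 2))) + 2 * η) / 4 := by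
    rw [← h3]; field_simp
  generalize (z : K) = t at *
  have h4 : η ^ 2 = (t ^ 2 - 2) * (2 + (t ^ 2 - 2) * ω) := by
    linear_combination h2 + 2 * (t ^ 2 - 2) * h1
  have e3 : ω ^ 3 = ((t ^ 2 - 2) ^ 2 + 1) * ω + (t ^ 2 - 2) := by
    linear_combination (ω + (t ^ 2 - 2)) * h1
  have e4 : ω ^ 4 = ((t ^ 2 - 2) ^ 3 + 2 * (t ^ 2 - 2)) * ω + (t ^ 2 - 2) ^ 2 + 1 := by
    linear_combination ω * e3 + ((t ^ 2 - 2) ^ 2 + 1) * h1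
  have f3 : η ^ 3 = (t ^ 2 - 2) * (2 + (t ^ 2 - 2) * ω) * η := by linear_combination η * h4
  have f4 : η ^ 4 = ((t ^ 2 - 2) * (2 + (t ^ 2 - 2) * ω)) ^ 2 := by
    linear_combination (η ^ 2 + (t ^ 2 - 2) * (2 + (t ^ 2 - 2) * ω)) * h4
  field_simp
  ring_nf
  simp only [f3, f4, h4, e3, e4, h1]
  ring_nf
  simp only [h1]
  ring_nf

theorem QuarticData.quadUnit_eq (h : QuarticData z θ ω η) : quadUnit z θ = ω := by
  have : CharZero K := algebraRat.charZero K
  obtain ⟨h1, h2, h3⟩ := h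
  obtain rfl : θ = (z * (1 + (2 * ω - ((z : K) ^ 2 - 2))) + 2 * η) / 4 := by
    rw [← h3]; field_simp
  rw [quadUnit]
  generalize (z : K) = t at *
  have h4 : η ^ 2 = (t ^ 2 - 2) * (2 + (t ^ 2 - 2) * ω) := by
    linear_combination h2 + 2 * (t ^ 2 - 2) * h1
  have e3 : ω ^ 3 = ((t ^ 2 - 2) ^ 2 + 1) * ω + (t ^ 2 - 2) := by
    linear_combination (ω + (t ^ 2 - 2)) * h1
  have f3 : η ^ 3 = (t ^ 2 - 2) * (2 + (t ^ 2 - 2) * ω) * η := by linear_combination η * h4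
  field_simp
  ring_nf
  simp only [f3, h4, e3, h1]
  ring_nf
  simp only [h1]
  ring_nf

/-- The action of a generator of the Galois group: `ω ↦ -1 / ω = m - ω` and
`η ↦ η / ω = η (ω - m)`. -/
theorem QuarticData.conj (h : QuarticData z θ ω η) :
    QuarticData z ((z * (1 - (2 * ω - ((z : K) ^ 2 - 2))) + 2 * (η * (ω - ((z : K) ^ 2 - 2)))) / 4)
      ((z : K) ^ 2 - 2 - ω) (η * (ω - ((z : K) ^ 2 - 2))) := by
  have : CharZero K := algebraRat.charZero K
  obtain ⟨h1, h2, h3⟩ := h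
  refine ⟨by linear_combination h1, ?_, by field_simp; ring⟩
  generalize (z : K) = t at *
  rw [mul_pow, h2]
  linear_combination ((t ^ 2 - 2) * (2 * ω - (t ^ 2 - 2)) * (ω - (t ^ 2 - 2))) * h1

/-- The four roots of `f_z` in terms of one of them. -/
theorem QuarticData.eq_of_root (h : QuarticData z θ ω η) {x : K}
    (hx : aeval x (quarticF z) = 0) :
    x = θ ∨ x = θ - η ∨
      x = (z * (1 - (2 * ω - ((z : K) ^ 2 - 2))) + 2 * (η * (ω - ((z : K) ^ 2 - 2)))) / 4 ∨
      x = (z * (1 - (2 * ω - ((z : K) ^ 2 - 2))) - 2 * (η * (ω - ((z : K) ^ 2 - 2)))) / 4 := by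
  have : CharZero K := algebraRat.charZero K
  have h' := QuarticData.of_root hx
  -- `quadUnit z x` and `ω` are roots of the same quadratic polynomial, with roots `ω` and `m - ω`.
  have hcase : (quadUnit z x - ω) * (quadUnit z x - ((z : K) ^ 2 - 2 - ω)) = 0 := by
    linear_combination h'.sq_omega - h.sq_omega
  rcases mul_eq_zero.1 hcase with h1 | h1
  · rw [sub_eq_zero.1 h1] at h'
    rcases sq_eq_sq_iff_eq_or_eq_neg.1 (h'.sq_eta.trans h.sq_eta.symm) with h2 | h2
    · left; linear_combination h2 / 2 - h.four_theta / 4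
    · right; left; linear_combination h2 / 2 - h.four_theta / 4
  · rw [sub_eq_zero.1 h1] at h'
    right; right
    rcases sq_eq_sq_iff_eq_or_eq_neg.1 (h'.sq_eta.trans h.conj.sq_eta.symm) with h2 | h2
    · left; linear_combination h2 / 2
    · right; linear_combination h2 / 2

end

/-! ### Linear independence over the rationals -/

theorem int_sq_sub_two_ne_zero (z : ℤ) : z ^ 2 - 2 ≠ 0 := by
  intro h
  have h1 : z < 2 := by nlinarith
  have h2 : -2 < z := by nlinarith
  interval_cases z <;> omega

/-- For `m ≠ 0` the number `m ^ 2 + 4` lies strictly between `m ^ 2` and `(|m| + 2) ^ 2`, and it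
differs from `(|m| + 1) ^ 2` by parity. -/
theorem int_sq_ne_sq_add_four {m : ℤ} (hm : m ≠ 0) (n : ℤ) : n ^ 2 ≠ m ^ 2 + 4 := by
  intro h
  wlog hm0 : 0 < m generalizing m
  · exact this (neg_ne_zero.2 hm) (by simpa using h) (by omega)
  wlog hn0 : 0 ≤ n generalizing n
  · exact this (-n) (by simpa using h) (by omega)
  have h1 : m < n := by nlinarith
  have h2 : n < m + 2 := by nlinarith
  obtain rfl : n = m + 1 := by omega
  ring_nf at h
  omega

theorem rat_sq_ne_sq_add_four (z : ℤ) (q : ℚ) : q ^ 2 ≠ ((z : ℚ) ^ 2 - 2) ^ 2 + 4 := by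
  intro h
  have h1 : IsSquare (((z ^ 2 - 2) ^ 2 + 4 : ℤ) : ℚ) := ⟨q, by push_cast; rw [← h, sq]⟩
  obtain ⟨n, hn⟩ := Rat.isSquare_intCast_iff.1 h1
  exact int_sq_ne_sq_add_four (int_sq_sub_two_ne_zero z) n (by rw [hn, sq])

theorem rat_sq_sub_two_ne_zero (z : ℤ) : (z : ℚ) ^ 2 - 2 ≠ 0 := by
  exact_mod_cast int_sq_sub_two_ne_zero z

section
variable {K : Type*} [Field K] [Algebra ℚ K] {z : ℤ} {θ ω η : K}

/-- The norm form of `ℚ(ω)` in the basis `1, ω` is anisotropic. -/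
theorem rat_norm_ne_zero (z : ℤ) {r s : ℚ} (h : ¬ (r = 0 ∧ s = 0)) :
    r ^ 2 + r * s * ((z : ℚ) ^ 2 - 2) - s ^ 2 ≠ 0 := by
  intro h0
  have hs : s = 0 := by
    by_contra hq
    refine rat_sq_ne_sq_add_four z ((2 * r + s * ((z : ℚ) ^ 2 - 2)) / s) ?_
    field_simp
    linear_combination 4 * h0
  subst hs
  exact h ⟨by simpa using h0, rfl⟩

theorem QuarticData.rat_indep_omega (h : QuarticData z θ ω η) {p q : ℚ}
    (hpq : algebraMap ℚ K p + algebraMap ℚ K q * ω = 0) : p = 0 ∧ q = 0 := by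
  by_contra hne
  refine rat_norm_ne_zero z hne ((algebraMap ℚ K).injective ?_)
  simp only [map_sub, map_mul, map_add, map_pow, map_intCast, map_ofNat, map_zero]
  linear_combination (algebraMap ℚ K p + algebraMap ℚ K q * ((z : K) ^ 2 - 2 - ω)) * hpq
    + (algebraMap ℚ K q) ^ 2 * h.sq_omega

/-- `η` does not lie in `ℚ(ω)`: otherwise the norm `m ^ 2 d` of `η ^ 2` would be a rational
square. -/
theorem QuarticData.eta_ne (h : QuarticData z θ ω η) (u v : ℚ) :
    η ≠ algebraMap ℚ K u + algebraMap ℚ K v * ω := by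
  intro he
  have h0 := h.sq_eta
  rw [he] at h0
  have h1 : algebraMap ℚ K (u ^ 2 + v ^ 2 - 2 * ((z : ℚ) ^ 2 - 2))
      + algebraMap ℚ K (2 * u * v + v ^ 2 * ((z : ℚ) ^ 2 - 2) - ((z : ℚ) ^ 2 - 2) ^ 2) * ω = 0 := by
    simp only [map_sub, map_mul, map_add, map_pow, map_intCast, map_ofNat]
    linear_combination h0 + (2 * ((z : K) ^ 2 - 2) - (algebraMap ℚ K v) ^ 2) * h.sq_omega
  obtain ⟨e1, e2⟩ := h.rat_indep_omega h1
  have hm := rat_sq_sub_two_ne_zero z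
  generalize hmz : (z : ℚ) ^ 2 - 2 = m at *
  -- The norm `u ^ 2 + u v m - v ^ 2` of `η` has square `m ^ 2 d`.
  refine rat_sq_ne_sq_add_four z ((u ^ 2 + u * v * m - v ^ 2) / m) ?_
  rw [hmz]
  field_simp
  linear_combination (u ^ 2 + v ^ 2 + 2 * m + m * (2 * u * v + v ^ 2 * m)) * e1
    + (m ^ 2 - (2 * u * v + v ^ 2 * m)) * e2

theorem QuarticData.rat_indep (h : QuarticData z θ ω η) {p q r s : ℚ}
    (h0 : algebraMap ℚ K p + algebraMap ℚ K q * ω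
      + (algebraMap ℚ K r + algebraMap ℚ K s * ω) * η = 0) :
    p = 0 ∧ q = 0 ∧ r = 0 ∧ s = 0 := by
  by_cases hrs : r = 0 ∧ s = 0
  · obtain ⟨rfl, rfl⟩ := hrs
    obtain ⟨h1, h2⟩ := h.rat_indep_omega (p := p) (q := q) (by simpa using h0)
    exact ⟨h1, h2, rfl, rfl⟩
  · exfalso
    have hN := rat_norm_ne_zero z hrs
    -- Divide by `r + s ω`, using its conjugate `r + s (m - ω)` and its norm `N`.
    set N := r ^ 2 + r * s * ((z : ℚ) ^ 2 - 2) - s ^ 2 with hNdef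
    have hNK : algebraMap ℚ K N ≠ 0 := (_root_.map_ne_zero _).2 hN
    refine h.eta_ne (-(p * r + p * s * ((z : ℚ) ^ 2 - 2) - q * s) / N)
      (-(q * r - p * s) / N) ?_
    rw [map_div₀, map_div₀]
    field_simp
    rw [hNdef]
    simp only [map_sub, map_mul, map_add, map_pow, map_intCast, map_ofNat, map_neg]
    linear_combination (algebraMap ℚ K r + algebraMap ℚ K s * ((z : K) ^ 2 - 2 - ω)) * h0
      + ((algebraMap ℚ K s) ^ 2 * η + algebraMap ℚ K q * algebraMap ℚ K s) * h.sq_omega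

theorem QuarticData.linearIndependent (h : QuarticData z θ ω η) :
    LinearIndependent ℚ ![1, ω, η, ω * η] := by
  rw [Fintype.linearIndependent_iff]
  intro g hg
  simp only [Fin.sum_univ_four, Algebra.smul_def] at hg
  simp at hg
  obtain ⟨h1, h2, h3, h4⟩ := h.rat_indep (p := g 0) (q := g 1) (r := g 2) (s := g 3)
    (by simp; linear_combination hg)
  intro i
  fin_cases i <;> assumption

theorem QuarticData.four_le_finrank [FiniteDimensional ℚ K] (h : QuarticData z θ ω η) :
    4 ≤ Module.finrank ℚ K := by
  simpa using h.linearIndependent.fintype_card_le_finrank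

theorem QuarticData.span_eq_top (h : QuarticData z θ ω η) (h4 : Module.finrank ℚ K = 4) :
    Submodule.span ℚ (Set.range ![1, ω, η, ω * η]) = ⊤ := by
  have : FiniteDimensional ℚ K := Module.finite_of_finrank_pos (by rw [h4]; norm_num)
  exact h.linearIndependent.span_eq_top_of_card_eq_finrank (by rw [h4, Fintype.card_fin])

theorem QuarticData.map {L : Type*} [Field L] [Algebra ℚ L] (σ : K →ₐ[ℚ] L)
    (h : QuarticData z θ ω η) : QuarticData z (σ θ) (σ ω) (σ η) := by
  have e : σ 2 = 2 := map_ofNat σ 2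
  have e' : σ 4 = 4 := map_ofNat σ 4
  refine ⟨?_, ?_, ?_⟩
  · simpa [e] using congrArg σ h.sq_omega
  · simpa [e] using congrArg σ h.sq_eta
  · simpa [e, e'] using congrArg σ h.four_theta

end

/-! ### Irreducibility and the Galois group -/

theorem quarticF_monic (z : ℤ) : (quarticF z).Monic := by
  unfold quarticF
  monicity!

theorem quarticF_natDegree (z : ℤ) : (quarticF z).natDegree = 4 := by
  unfold quarticF
  compute_degree!

section
variable {K : Type*} [Field K] [Algebra ℚ K] {z : ℤ} {θ ω η : K}

theorem isIntegral_rat_of_root (h : aeval θ (quarticF z) = 0) : IsIntegral ℚ θ :=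
  ⟨_, quarticF_monic z, by simpa [aeval_def] using h⟩

theorem minpoly_eq_quarticF (h : aeval θ (quarticF z) = 0) : minpoly ℚ θ = quarticF z := by
  have hint := isIntegral_rat_of_root h
  have : FiniteDimensional ℚ ℚ⟮θ⟯ := adjoin.finiteDimensional hint
  have h' : aeval (AdjoinSimple.gen ℚ θ) (quarticF z) = 0 := by
    apply (algebraMap ℚ⟮θ⟯ K).injective
    rw [map_zero, ← aeval_algebraMap_apply, AdjoinSimple.algebraMap_gen, h]
  -- The `ℚ`-algebra structure of `ℚ⟮θ⟯` is given explicitly: instance search would choose the one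
  -- that comes from characteristic zero.
  have h4 := (@QuarticData.four_le_finrank _ _ ℚ⟮θ⟯.algebra' _ _ _ _ this
    (QuarticData.of_root h')).trans_eq (adjoin.finrank hint)
  refine (eq_of_monic_of_dvd_of_natDegree_le (minpoly.monic hint) (quarticF_monic z)
    (minpoly.dvd ℚ θ h) ?_).symm
  rwa [quarticF_natDegree]

theorem finrank_eq_four (h : aeval θ (quarticF z) = 0) (htop : ℚ⟮θ⟯ = ⊤) :
    Module.finrank ℚ K = 4 := by
  rw [← finrank_top', ← htop, adjoin.finrank (isIntegral_rat_of_root h), minpoly_eq_quarticF h,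
    quarticF_natDegree]

theorem QuarticData.exists_rat_coords (h : QuarticData z θ ω η) (htop : ℚ⟮θ⟯ = ⊤) (x : K) :
    ∃ p q r s : ℚ, x = algebraMap ℚ K p + algebraMap ℚ K q * ω
      + (algebraMap ℚ K r + algebraMap ℚ K s * ω) * η := by
  have hspan := h.span_eq_top (finrank_eq_four h.root htop)
  have hx : x ∈ Submodule.span ℚ (Set.range ![1, ω, η, ω * η]) := hspan ▸ Submodule.mem_top
  obtain ⟨c, hc⟩ := (Submodule.mem_span_range_iff_exists_fun ℚ).1 hx
  refine ⟨c 0, c 1, c 2, c 3, ?_⟩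
  rw [← hc, Fin.sum_univ_four]
  simp [Algebra.smul_def]
  ring

theorem QuarticData.exists_algEquiv (h : QuarticData z θ ω η) (htop : ℚ⟮θ⟯ = ⊤) :
    ∃ σ : K ≃ₐ[ℚ] K, σ ω = (z : K) ^ 2 - 2 - ω ∧ σ η = η * (ω - ((z : K) ^ 2 - 2)) := by
  have : CharZero K := algebraRat.charZero K
  have hint := isIntegral_rat_of_root h.root
  have htop' : Algebra.adjoin ℚ {θ} = ⊤ := by
    rw [← adjoin_simple_toSubalgebra_of_isAlgebraic hint.isAlgebraic, htop, top_toSubalgebra]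
  have hfd : FiniteDimensional ℚ K :=
    Module.finite_of_finrank_pos (by rw [finrank_eq_four h.root htop]; norm_num)
  let pb := PowerBasis.ofAdjoinEqTop hint htop'
  have hgen : pb.gen = θ := PowerBasis.ofAdjoinEqTop_gen hint htop'
  obtain ⟨τ, hτ⟩ : ∃ τ : K →ₐ[ℚ] K, τ θ =
      (z * (1 - (2 * ω - ((z : K) ^ 2 - 2))) + 2 * (η * (ω - ((z : K) ^ 2 - 2)))) / 4 := by
    have hroot := h.conj.root
    rw [← minpoly_eq_quarticF h.root, ← hgen] at hroot
    exact ⟨pb.lift _ hroot, (congrArg _ hgen.symm).trans (pb.lift_gen _ hroot)⟩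
  have hω : τ ω = (z : K) ^ 2 - 2 - ω := by
    rw [← (h.map τ).quadUnit_eq, hτ, h.conj.quadUnit_eq]
  refine ⟨AlgEquiv.ofBijective τ (Algebra.IsAlgebraic.algHom_bijective τ), hω, ?_⟩
  have h4 := congrArg τ h.four_theta
  simp only [map_mul, map_add, map_sub, map_pow, map_intCast, map_ofNat, map_one, hτ, hω] at h4
  change τ η = _
  linear_combination -h4 / 2

theorem QuarticData.eta_ne_zero (h : QuarticData z θ ω η) : η ≠ 0 := by
  intro h0
  simpa using h.rat_indep (p := 0) (q := 0) (r := 1) (s := 0) (by simp [h0])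

/-- The lift of the conjugation of `ℚ(ω)` squares to a nontrivial automorphism. -/
theorem QuarticData.sigma_sigma_eta (h : QuarticData z θ ω η) (σ : K ≃ₐ[ℚ] K)
    (h1 : σ ω = (z : K) ^ 2 - 2 - ω) (h2 : σ η = η * (ω - ((z : K) ^ 2 - 2))) :
    σ (σ η) = -η := by
  rw [h2]
  simp only [map_mul, map_sub, map_pow, map_intCast, map_ofNat, h1, h2]
  linear_combination -η * h.sq_omega

theorem QuarticData.mem_range_of_root {L : Type*} [Field L] [Algebra ℚ L] (σ : K →ₐ[ℚ] L)
    (h : QuarticData z θ ω η) {x : L} (hx : aeval x (quarticF z) = 0) : ∃ y, σ y = x := by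
  have e : σ 2 = 2 := map_ofNat σ 2
  have e' : σ 4 = 4 := map_ofNat σ 4
  rcases (h.map σ).eq_of_root hx with rfl | rfl | rfl | rfl
  · exact ⟨θ, rfl⟩
  · exact ⟨θ - η, map_sub σ _ _⟩
  · exact ⟨(z * (1 - (2 * ω - ((z : K) ^ 2 - 2))) + 2 * (η * (ω - ((z : K) ^ 2 - 2)))) / 4,
      by simp [e, e']⟩
  · exact ⟨(z * (1 - (2 * ω - ((z : K) ^ 2 - 2))) - 2 * (η * (ω - ((z : K) ^ 2 - 2)))) / 4,
      by simp [e, e']⟩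

theorem mem_adjoin_of_root {x : K} (h : aeval θ (quarticF z) = 0)
    (hx : aeval x (quarticF z) = 0) : x ∈ ℚ⟮θ⟯ := by
  have h' : aeval (AdjoinSimple.gen ℚ θ) (quarticF z) = 0 := by
    apply (algebraMap ℚ⟮θ⟯ K).injective
    rw [map_zero, ← aeval_algebraMap_apply, AdjoinSimple.algebraMap_gen, h]
  have hd := QuarticData.of_root h'
  obtain ⟨y, rfl⟩ := @QuarticData.mem_range_of_root ℚ⟮θ⟯ _ ℚ⟮θ⟯.algebra' _ _ _ _ K _ _
    ℚ⟮θ⟯.val hd _ hx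
  exact y.2

theorem quarticF_irreducible (z : ℤ) : Irreducible (quarticF z) := by
  obtain ⟨x, hx⟩ := IsAlgClosed.exists_aeval_eq_zero ℂ (quarticF z)
    (by rw [degree_eq_natDegree (quarticF_monic z).ne_zero, quarticF_natDegree]; norm_num)
  rw [← minpoly_eq_quarticF hx]
  exact minpoly.irreducible (isIntegral_rat_of_root hx)

theorem adjoin_eq_top_of_isSplittingField [IsSplittingField ℚ K (quarticF z)]
    (h : aeval θ (quarticF z) = 0) : ℚ⟮θ⟯ = ⊤ := by
  have hle : Algebra.adjoin ℚ ((quarticF z).rootSet K) ≤ ℚ⟮θ⟯.toSubalgebra :=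
    Algebra.adjoin_le fun x hx => mem_adjoin_of_root h (mem_rootSet.1 hx).2
  rw [IsSplittingField.adjoin_rootSet K (quarticF z)] at hle
  exact eq_top_iff.2 fun x _ => hle Algebra.mem_top

theorem isCyclic_algEquiv [IsSplittingField ℚ K (quarticF z)] :
    IsCyclic (K ≃ₐ[ℚ] K) ∧ Nat.card (K ≃ₐ[ℚ] K) = 4 := by
  have : CharZero K := algebraRat.charZero K
  have hirr := quarticF_irreducible z
  obtain ⟨θ, hθ⟩ : ∃ θ : K, aeval θ (quarticF z) = 0 := by
    obtain ⟨θ, hθ⟩ := (IsSplittingField.splits K (quarticF z)).exists_eval_eq_zero (by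
      rw [degree_map, degree_eq_natDegree (quarticF_monic z).ne_zero, quarticF_natDegree]
      norm_num)
    exact ⟨θ, by rwa [eval_map_algebraMap] at hθ⟩
  have htop := adjoin_eq_top_of_isSplittingField hθ
  have hd := QuarticData.of_root hθ
  obtain ⟨σ, hσ1, hσ2⟩ := hd.exists_algEquiv htop
  have hσσ := hd.sigma_sigma_eta σ hσ1 hσ2
  have : FiniteDimensional ℚ K := IsSplittingField.finiteDimensional K (quarticF z)
  have : IsGalois ℚ K := IsGalois.of_separable_splitting_field hirr.separable
  have hcard : Nat.card (K ≃ₐ[ℚ] K) = 4 := by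
    rw [IsGalois.card_aut_eq_finrank, finrank_eq_four hθ htop]
  have hg2 : σ ^ 2 ≠ 1 := fun h2 =>
    hd.eta_ne_zero (self_eq_neg.1 ((DFunLike.congr_fun h2 _).symm.trans hσσ))
  have hord : orderOf σ = 4 := by
    have h4 : orderOf σ ∣ 2 ^ 2 := by
      rw [← show Nat.card (K ≃ₐ[ℚ] K) = 2 ^ 2 from hcard]; exact orderOf_dvd_natCard σ
    obtain ⟨k, hk, hk'⟩ := (Nat.dvd_prime_pow Nat.prime_two).1 h4
    have hk2 : ¬ k ≤ 1 := fun hk1 => hg2 (orderOf_dvd_iff_pow_eq_one.1 (by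
      rw [hk']; exact (pow_dvd_pow 2 hk1).trans (by norm_num)))
    obtain rfl : k = 2 := by omega
    simpa using hk'
  exact ⟨isCyclic_of_orderOf_eq_card σ (by rw [hord, hcard]), hcard⟩

theorem nonempty_gal_mulEquiv (z : ℤ) :
    Nonempty ((quarticF z).Gal ≃* Multiplicative (ZMod 4)) := by
  obtain ⟨hcyc, hcard⟩ : IsCyclic (quarticF z).Gal ∧ Nat.card (quarticF z).Gal = 4 :=
    @isCyclic_algEquiv (quarticF z).SplittingField _ _ z (IsSplittingField.splittingField _)
  exact ⟨mulEquivOfCyclicCardEq (by rw [hcard]; simp)⟩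

end

/-! ### Real roots -/

theorem Complex.im_eq_zero_of_sq_eq {x : ℂ} {r : ℝ} (hr : 0 ≤ r) (h : x ^ 2 = r) : x.im = 0 := by
  have h1 : x ^ 2 = ((√r : ℝ) : ℂ) ^ 2 := by
    rw [h, ← Complex.ofReal_pow, Real.sq_sqrt hr]
  rcases sq_eq_sq_iff_eq_or_eq_neg.1 h1 with rfl | rfl <;> simp

theorem im_eq_zero_of_root {z : ℤ} (hz : 2 ≤ |z|) {ϑ : ℂ} (h : aeval ϑ (quarticF z) = 0) :
    ϑ.im = 0 := by
  have hd := QuarticData.of_root h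
  generalize quadUnit z ϑ = ω at hd
  generalize 2 * ϑ - z * (1 + (2 * ω - ((z : ℂ) ^ 2 - 2))) / 2 = η at hd
  obtain ⟨h1, h2, h3⟩ := hd
  have hz2 : (4 : ℝ) ≤ (z : ℝ) ^ 2 := by
    have : (2 : ℤ) ^ 2 ≤ z ^ 2 := sq_le_sq.2 (by simpa using hz)
    exact_mod_cast this
  -- `w ^ 2 = d > 0`, so `ω` is real; then `η ^ 2 = m (ω ^ 2 + 1) ≥ 0`.
  have hw : (2 * ω - ((z : ℂ) ^ 2 - 2)).im = 0 :=
    Complex.im_eq_zero_of_sq_eq (r := ((z : ℝ) ^ 2 - 2) ^ 2 + 4) (by positivity)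
      (by push_cast; linear_combination 4 * h1)
  obtain ⟨t, rfl⟩ : ∃ t : ℝ, (t : ℂ) = ω := by
    refine ⟨ω.re, Complex.ext (by simp) (Eq.symm ?_)⟩
    have e : ((z : ℂ) ^ 2 - 2) = (((z : ℝ) ^ 2 - 2 : ℝ) : ℂ) := by push_cast; rfl
    rw [e, Complex.sub_im, Complex.ofReal_im] at hw
    rw [Complex.ofReal_im]
    simpa using hw
  have hη : η.im = 0 :=
    Complex.im_eq_zero_of_sq_eq (r := ((z : ℝ) ^ 2 - 2) * (t ^ 2 + 1))
      (mul_nonneg (by linarith) (by positivity))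
      (by push_cast; linear_combination h2 + ((z : ℂ) ^ 2 - 2) * h1)
  have e : 4 * ϑ = (((z : ℝ) * (1 + (2 * t - ((z : ℝ) ^ 2 - 2))) : ℝ) : ℂ) + 2 * η := by
    push_cast; exact h3
  have := congrArg Complex.im e
  rw [Complex.add_im, Complex.ofReal_im] at this
  simpa [hη] using this

/-! ### Integrality of rational coefficients -/

theorem Rat.exists_int_of_sq {q : ℚ} (h : ∃ n : ℤ, q ^ 2 = n) : ∃ n : ℤ, q = n := by
  obtain ⟨n, hn⟩ := h
  have hint : IsIntegral ℤ q := IsIntegral.of_pow (n := 2) two_pos (by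
    rw [hn]; exact isIntegral_algebraMap (R := ℤ) (A := ℚ))
  obtain ⟨k, hk⟩ := IsIntegrallyClosed.isIntegral_iff.1 hint
  exact ⟨k, by simpa using hk.symm⟩

/-- If `D q ^ 2` is an integer and `D` is squarefree, then `q` is an integer. -/
theorem Rat.exists_int_of_squarefree_mul_sq {D : ℤ} (hD : Squarefree D) {q : ℚ}
    (h : ∃ n : ℤ, D * q ^ 2 = n) : ∃ n : ℤ, q = n := by
  obtain ⟨n, hn⟩ := h
  obtain ⟨c, hc⟩ := Rat.exists_int_of_sq (q := D * q) ⟨D * n, by push_cast; rw [← hn]; ring⟩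
  have h1 : D ∣ c ^ 2 := ⟨n, by
    have : (c : ℚ) ^ 2 = D * n := by rw [← hc, ← hn]; ring
    exact_mod_cast this⟩
  obtain ⟨k, rfl⟩ := (hD.dvd_pow_iff_dvd two_ne_zero).1 h1
  refine ⟨k, ?_⟩
  have : (D : ℚ) ≠ 0 := by exact_mod_cast hD.ne_zero
  push_cast at hc
  exact mul_left_cancel₀ this hc

/-- The coefficient step for odd `z`. The two hypotheses say that
`m w (R + S w) ^ 2 / 4`, with `w ^ 2 = d`, has integral trace and norm; the conclusion says that
`(R + S w) / 2` is integral. Squarefreeness of `m d` is the squarefreeness of the relative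
discriminant. -/
theorem odd_coeff_integral {m d : ℤ} (hd : d = m ^ 2 + 4) (hodd : Odd m) (hm : Squarefree m)
    (hds : Squarefree d) {R S : ℚ} (h1 : ∃ a : ℤ, 2 * (m * R * S * d / 2) = a)
    (h2 : ∃ b : ℤ, (m * R * S * d / 2) ^ 2 - d * (m * (R ^ 2 + d * S ^ 2) / 4) ^ 2 = b) :
    ∃ r s : ℤ, (R - S * m) / 2 = r ∧ S = s := by
  obtain ⟨a, ha⟩ := h1
  obtain ⟨b, hb⟩ := h2
  obtain ⟨n, hn⟩ := Rat.exists_int_of_squarefree_mul_sq hds (q := m * (R ^ 2 + d * S ^ 2) / 2)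
    ⟨a ^ 2 - 4 * b, by push_cast; rw [← ha, ← hb]; ring⟩
  -- The norm of `R + S w` is `R ^ 2 - d S ^ 2`; together with `R ^ 2 + d S ^ 2` it separates
  -- `R ^ 2` from `d S ^ 2`.
  obtain ⟨e, he⟩ := Rat.exists_int_of_squarefree_mul_sq hds (q := m * (R ^ 2 - d * S ^ 2) / 2)
    ⟨d * n ^ 2 - a ^ 2, by push_cast; rw [← ha, ← hn]; ring⟩
  have hcop : IsCoprime m d := by
    have h4 : IsCoprime m (2 ^ 2) := (Int.isCoprime_two_right.2 hodd).pow_right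
    obtain ⟨u, v, huv⟩ := h4
    exact ⟨u - v * m, v, by rw [hd]; linear_combination huv⟩
  obtain ⟨r, hr⟩ := Rat.exists_int_of_squarefree_mul_sq hm (q := R)
    ⟨n + e, by push_cast; rw [← hn, ← he]; ring⟩
  obtain ⟨s, hs⟩ := Rat.exists_int_of_squarefree_mul_sq
    (squarefree_mul_iff.2 ⟨hcop.isRelPrime, hm, hds⟩) (q := S)
    ⟨n - e, by push_cast; rw [← hn, ← he]; ring⟩
  subst hr hs
  have h3 : m * (r ^ 2 + d * s ^ 2) = 2 * n := by
    have : (m : ℚ) * (r ^ 2 + d * s ^ 2) = 2 * n := by rw [← hn]; ring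
    exact_mod_cast this
  have hpar : Even (r - s * m) := by
    have h5 : Even (m * (r ^ 2 + d * s ^ 2)) := h3 ▸ even_two_mul n
    have hdo : ¬ Even d := by
      rw [hd, Int.even_add, Int.even_pow]; simp [Int.not_even_iff_odd.2 hodd]; decide
    have hmo := Int.not_even_iff_odd.2 hodd
    simp only [Int.even_mul, Int.even_add, Int.even_pow, Int.even_sub] at h5 ⊢
    tauto
  obtain ⟨k, hk⟩ := hpar
  refine ⟨k, s, ?_, rfl⟩
  have : (r : ℚ) - s * m = k + k := by exact_mod_cast hk
  linarith

/-- The coefficient step for even `z`, where `m = 2 m'` and `d = 4 D`. The prime `2` is wildly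
ramified, so only a bounded power of `2` can be left in the denominators. -/
theorem even_coeff_integral {m' D : ℤ} (hD : D = m' ^ 2 + 1) (hm : Squarefree m')
    (hDs : Squarefree D) {R S : ℚ} (h1 : ∃ a : ℤ, 2 * ((2 * m') * R * S * (4 * D) / 2) = a)
    (h2 : ∃ b : ℤ, ((2 * m') * R * S * (4 * D) / 2) ^ 2
      - (4 * D) * ((2 * m') * (R ^ 2 + (4 * D) * S ^ 2) / 4) ^ 2 = b) :
    ∃ r s : ℤ, 2 * R = r ∧ 4 * S = s := by
  obtain ⟨a, ha⟩ := h1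
  obtain ⟨b, hb⟩ := h2
  obtain ⟨n, hn⟩ := Rat.exists_int_of_squarefree_mul_sq hDs
    (q := (2 * m') * (R ^ 2 + (4 * D) * S ^ 2))
    ⟨a ^ 2 - 4 * b, by push_cast; rw [← ha, ← hb]; ring⟩
  obtain ⟨e, he⟩ := Rat.exists_int_of_squarefree_mul_sq hDs
    (q := (2 * m') * (R ^ 2 - (4 * D) * S ^ 2))
    ⟨D * n ^ 2 - a ^ 2, by push_cast; rw [← ha, ← hn]; ring⟩
  have hcop : IsCoprime m' D := ⟨-m', 1, by rw [hD]; ring⟩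
  obtain ⟨r, hr⟩ := Rat.exists_int_of_squarefree_mul_sq hm (q := 2 * R)
    ⟨n + e, by push_cast; rw [← hn, ← he]; ring⟩
  obtain ⟨s, hs⟩ := Rat.exists_int_of_squarefree_mul_sq
    (squarefree_mul_iff.2 ⟨hcop.isRelPrime, hm, hDs⟩) (q := 4 * S)
    ⟨n - e, by push_cast; rw [← hn, ← he]; ring⟩
  exact ⟨r, s, hr, hs⟩

/-- Integers of the quadratic field for odd `z`: if `A + B w` has integral trace and norm, then
`A + B w = (A - B m) + 2 B ω` lies in `ℤ[ω]`. -/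
theorem odd_quadratic_integral {m d : ℤ} (hd : d = m ^ 2 + 4) (hodd : Odd m)
    (hds : Squarefree d) {A B : ℚ} (h1 : ∃ a : ℤ, 2 * A = a)
    (h2 : ∃ b : ℤ, A ^ 2 - d * B ^ 2 = b) : ∃ r s : ℤ, A - B * m = r ∧ 2 * B = s := by
  obtain ⟨a, ha⟩ := h1
  obtain ⟨b, hb⟩ := h2
  obtain ⟨n, hn⟩ := Rat.exists_int_of_squarefree_mul_sq hds (q := 2 * B)
    ⟨a ^ 2 - 4 * b, by push_cast; rw [← ha, ← hb]; ring⟩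
  have h3 : a ^ 2 - d * n ^ 2 = 2 * (2 * b) := by
    have : (a : ℚ) ^ 2 - d * n ^ 2 = 2 * (2 * b) := by rw [← hn, ← ha, ← hb]; ring
    exact_mod_cast this
  have hpar : Even (a - n * m) := by
    have h5 : Even (a ^ 2 - d * n ^ 2) := h3 ▸ even_two_mul _
    have hdo : ¬ Even d := by
      rw [hd, Int.even_add, Int.even_pow]; simp [Int.not_even_iff_odd.2 hodd]; decide
    have hmo := Int.not_even_iff_odd.2 hodd
    simp only [Int.even_mul, Int.even_pow, Int.even_sub] at h5 ⊢
    tauto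
  obtain ⟨k, hk⟩ := hpar
  refine ⟨k, n, ?_, hn⟩
  have : (a : ℚ) - n * m = k + k := by exact_mod_cast hk
  linear_combination this / 2 + ha / 2 - hn * m / 2

/-- Integers of the quadratic field for even `z`: if `A + B w` has integral trace and norm, then
`A + B w = (A - 2 B m') + 2 B ω` lies in `ℤ[ω]`. -/
theorem even_quadratic_integral {m' D : ℤ} (hD : D = m' ^ 2 + 1) (hodd : Odd m')
    (hDs : Squarefree D) {A B : ℚ} (h1 : ∃ a : ℤ, 2 * A = a)
    (h2 : ∃ b : ℤ, A ^ 2 - (4 * D) * B ^ 2 = b) :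
    ∃ r s : ℤ, A - B * (2 * m') = r ∧ 2 * B = s := by
  obtain ⟨a, ha⟩ := h1
  obtain ⟨b, hb⟩ := h2
  obtain ⟨l, hl⟩ := Rat.exists_int_of_squarefree_mul_sq hDs (q := 4 * B)
    ⟨a ^ 2 - 4 * b, by push_cast; rw [← ha, ← hb]; ring⟩
  have h3 : a ^ 2 - D * l ^ 2 = 4 * b := by
    have : (a : ℚ) ^ 2 - D * l ^ 2 = 4 * b := by rw [← hl, ← ha, ← hb]; ring
    exact_mod_cast this
  obtain ⟨u, hu⟩ := hodd
  -- `D` is twice an odd number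
  have hDu : D = 2 * (2 * u ^ 2 + 2 * u + 1) := by rw [hD, hu]; ring
  have ha2 : Even a := by
    have : Even (a ^ 2) := ⟨2 * b + (2 * u ^ 2 + 2 * u + 1) * l ^ 2, by
      rw [hDu] at h3; linear_combination h3⟩
    exact (Int.even_pow.1 this).1
  obtain ⟨a', rfl⟩ := ha2
  have hl2 : Even l := by
    have : Even (l ^ 2) := ⟨a' ^ 2 - b - (u ^ 2 + u) * l ^ 2, by
      rw [hDu] at h3; linarith [h3]⟩
    exact (Int.even_pow.1 this).1
  obtain ⟨l', rfl⟩ := hl2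
  push_cast at ha hl
  exact ⟨a' - l' * m', l', by push_cast; linear_combination ha / 2 - hl * m' / 2,
    by linear_combination hl / 2⟩

/-! ### Algebraic integers in coordinates -/

section
variable {K : Type*} [Field K] [Algebra ℚ K] {z : ℤ} {θ ω η : K}

theorem exists_int_of_isIntegral_algebraMap {q : ℚ} (h : IsIntegral ℤ (algebraMap ℚ K q)) :
    ∃ n : ℤ, q = n := by
  rw [isIntegral_algebraMap_iff (algebraMap ℚ K).injective] at h
  obtain ⟨k, hk⟩ := IsIntegrallyClosed.isIntegral_iff.1 h
  exact ⟨k, by simpa using hk.symm⟩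

theorem QuarticData.trace_norm_integral (h : QuarticData z θ ω η) (htop : ℚ⟮θ⟯ = ⊤) {A B : ℚ}
    (hint : IsIntegral ℤ (algebraMap ℚ K A + algebraMap ℚ K B * (2 * ω - ((z : K) ^ 2 - 2)))) :
    (∃ a : ℤ, 2 * A = a) ∧ ∃ b : ℤ, A ^ 2 - (((z : ℚ) ^ 2 - 2) ^ 2 + 4) * B ^ 2 = b := by
  obtain ⟨σ, hσ, -⟩ := h.exists_algEquiv htop
  have hint' := map_isIntegral_int σ hint
  have e : σ 2 = 2 := map_ofNat σ 2
  simp only [map_add, map_sub, map_mul, map_pow, map_intCast, e, hσ, AlgEquiv.commutes] at hint'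
  constructor
  · apply exists_int_of_isIntegral_algebraMap (K := K)
    have key : algebraMap ℚ K (2 * A) =
        algebraMap ℚ K A + algebraMap ℚ K B * (2 * ω - ((z : K) ^ 2 - 2)) +
        (algebraMap ℚ K A + algebraMap ℚ K B *
          (2 * ((z : K) ^ 2 - 2 - ω) - ((z : K) ^ 2 - 2))) := by
      simp only [map_mul, map_ofNat]
      ring
    rw [key]
    exact hint.add hint'
  · apply exists_int_of_isIntegral_algebraMap (K := K)
    have key : algebraMap ℚ K (A ^ 2 - (((z : ℚ) ^ 2 - 2) ^ 2 + 4) * B ^ 2) =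
        (algebraMap ℚ K A + algebraMap ℚ K B * (2 * ω - ((z : K) ^ 2 - 2))) *
        (algebraMap ℚ K A + algebraMap ℚ K B *
          (2 * ((z : K) ^ 2 - 2 - ω) - ((z : K) ^ 2 - 2))) := by
      simp only [map_sub, map_mul, map_add, map_pow, map_ofNat, map_intCast]
      linear_combination 4 * (algebraMap ℚ K B) ^ 2 * h.sq_omega
    rw [key]
    exact hint.mul hint'

/-- If `x + y η` with `x, y ∈ ℚ(ω)` is integral, then so is its relative discriminant
`4 y ^ 2 m w ω`, and hence `4 y ^ 2 m w`, because `ω` is a unit with inverse `ω - m`. -/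
theorem QuarticData.disc_integral (h : QuarticData z θ ω η) (htop : ℚ⟮θ⟯ = ⊤) {p q r s : ℚ}
    (hint : IsIntegral ℤ (algebraMap ℚ K p + algebraMap ℚ K q * ω
      + (algebraMap ℚ K r + algebraMap ℚ K s * ω) * η)) :
    IsIntegral ℤ (4 * (algebraMap ℚ K r + algebraMap ℚ K s * ω) ^ 2 * ((z : K) ^ 2 - 2)
      * (2 * ω - ((z : K) ^ 2 - 2))) := by
  obtain ⟨σ, hσ1, hσ2⟩ := h.exists_algEquiv htop
  have hσσ := h.sigma_sigma_eta σ hσ1 hσ2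
  have e : σ 2 = 2 := map_ofNat σ 2
  have hσσω : σ (σ ω) = ω := by
    simp only [hσ1, map_sub, map_pow, map_intCast, e]; ring
  have hint' := map_isIntegral_int σ (map_isIntegral_int σ hint)
  simp only [map_add, map_mul, hσσ, hσσω, AlgEquiv.commutes] at hint'
  have hω : IsIntegral ℤ (ω - ((z : K) ^ 2 - 2)) := by
    refine ⟨X ^ 2 + C (z ^ 2 - 2) * X - 1, by monicity!, ?_⟩
    simp only [eval₂_add, eval₂_sub, eval₂_mul, eval₂_pow, eval₂_X, eval₂_C, eval₂_one]
    simp only [algebraMap_int_eq, eq_intCast, Int.cast_sub, Int.cast_pow, Int.cast_ofNat]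
    linear_combination h.sq_omega
  have key : 4 * (algebraMap ℚ K r + algebraMap ℚ K s * ω) ^ 2 * ((z : K) ^ 2 - 2)
      * (2 * ω - ((z : K) ^ 2 - 2)) = (algebraMap ℚ K p + algebraMap ℚ K q * ω
      + (algebraMap ℚ K r + algebraMap ℚ K s * ω) * η - (algebraMap ℚ K p + algebraMap ℚ K q * ω
      + (algebraMap ℚ K r + algebraMap ℚ K s * ω) * -η)) ^ 2 * (ω - ((z : K) ^ 2 - 2)) := by
    linear_combination (-4 * (algebraMap ℚ K r + algebraMap ℚ K s * ω) ^ 2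
      * (ω - ((z : K) ^ 2 - 2))) * h.sq_eta - (4 * (algebraMap ℚ K r + algebraMap ℚ K s * ω) ^ 2
        * ((z : K) ^ 2 - 2) * (2 * ω - ((z : K) ^ 2 - 2))) * h.sq_omega
  rw [key]
  exact ((hint.sub hint').pow 2).mul hω

/-- Trace and norm of `4 y ^ 2 m w`, where `y = r + s ω = (R + S w) / 4`. -/
theorem QuarticData.disc_coords_integral (h : QuarticData z θ ω η) (htop : ℚ⟮θ⟯ = ⊤) {p q r s : ℚ}
    (hint : IsIntegral ℤ (algebraMap ℚ K p + algebraMap ℚ K q * ω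
      + (algebraMap ℚ K r + algebraMap ℚ K s * ω) * η)) (m d : ℚ) (hm : m = (z : ℚ) ^ 2 - 2)
      (hd : d = m ^ 2 + 4) (R S : ℚ) (hR : R = 4 * r + 2 * s * m) (hS : S = 2 * s) :
    (∃ a : ℤ, 2 * (m * R * S * d / 2) = a) ∧
      ∃ b : ℤ, (m * R * S * d / 2) ^ 2 - d * (m * (R ^ 2 + d * S ^ 2) / 4) ^ 2 = b := by
  have : CharZero K := algebraRat.charZero K
  have key : algebraMap ℚ K (m * R * S * d / 2)
      + algebraMap ℚ K (m * (R ^ 2 + d * S ^ 2) / 4) * (2 * ω - ((z : K) ^ 2 - 2))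
      = 4 * (algebraMap ℚ K r + algebraMap ℚ K s * ω) ^ 2 * ((z : K) ^ 2 - 2)
      * (2 * ω - ((z : K) ^ 2 - 2)) := by
    have hω := h.sq_omega
    subst hS hR hd hm
    simp only [map_sub, map_mul, map_add, map_pow, map_ofNat, map_intCast, map_div₀]
    generalize (z : K) ^ 2 - 2 = m at *
    generalize algebraMap ℚ K r = r at *
    generalize algebraMap ℚ K s = s at *
    linear_combination (-m * (2 * (4 * r + 2 * s * m) * (2 * s) + (2 * s) ^ 2 * (2 * ω - m))) * hω
  have h1 := h.trace_norm_integral htop (key ▸ h.disc_integral htop hint)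
  rwa [← hm, ← hd] at h1

/-- For odd `z` every algebraic integer lies in `ℤ[ω] + ℤ[ω] θ`. -/
theorem QuarticData.exists_int_coords_of_odd (h : QuarticData z θ ω η) (htop : ℚ⟮θ⟯ = ⊤)
    (hz : Odd z) (hS : SquarefreeConditions z) (hθ : IsIntegral ℤ θ) (hω : IsIntegral ℤ ω)
    {α : K} (hα : IsIntegral ℤ α) :
    ∃ a b c e : ℤ, α = a + b * ω + (c + e * ω) * θ := by
  have : CharZero K := algebraRat.charZero K
  have hm : Squarefree (z ^ 2 - 2) := hS.1
  have hmo : Odd (z ^ 2 - 2) := Odd.sub_even (hz.pow) even_two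
  have hd : Squarefree ((z ^ 2 - 2) ^ 2 + 4) := by
    have := hS.2.2 hz
    rwa [show (z ^ 2 - 2) ^ 2 + 4 = z ^ 4 - 4 * z ^ 2 + 8 by ring]
  obtain ⟨p, q, r, s, rfl⟩ := h.exists_rat_coords htop α
  obtain ⟨h1, h2⟩ := h.disc_coords_integral htop hα ((z ^ 2 - 2 : ℤ) : ℚ)
    (((z ^ 2 - 2) ^ 2 + 4 : ℤ) : ℚ) (by push_cast; rfl) (by push_cast; rfl) _ _ rfl rfl
  obtain ⟨c, e, hc, he⟩ := odd_coeff_integral rfl hmo hm hd h1 h2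
  have hr : algebraMap ℚ K r = c / 2 := by
    have : r = c / 2 := by rw [← hc]; ring
    rw [this]; simp
  have hs : algebraMap ℚ K s = e / 2 := by
    have : s = e / 2 := by rw [← he]; ring
    rw [this]; simp
  set m : ℚ := ((z ^ 2 - 2 : ℤ) : ℚ) with hmdef
  have hmK : algebraMap ℚ K m = (z : K) ^ 2 - 2 := by rw [hmdef, map_intCast]; push_cast; rfl
  -- `p' + q' ω` is `α - (c + e ω) θ`.
  set p' : ℚ := p - z * (c * (1 - m) + 2 * e) / 4 with hp'
  set q' : ℚ := q - z * (2 * c + e * (1 - m) + 2 * e * m) / 4 with hq'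
  have key : algebraMap ℚ K p + algebraMap ℚ K q * ω
      + (algebraMap ℚ K r + algebraMap ℚ K s * ω) * η
      = algebraMap ℚ K p' + algebraMap ℚ K q' * ω + (c + e * ω) * θ := by
    have hη : η = 2 * θ - z * (1 + (2 * ω - ((z : K) ^ 2 - 2))) / 2 := by
      linear_combination -h.four_theta / 2
    rw [hη, hr, hs, hp', hq']
    simp only [map_sub, map_mul, map_add, map_div₀, map_ofNat, map_intCast, map_one, hmK]
    linear_combination (-(e : K) * z / 2) * h.sq_omega
  rw [key] at hα ⊢
  have hx : IsIntegral ℤ (algebraMap ℚ K p' + algebraMap ℚ K q' * ω) := by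
    have hyθ : IsIntegral ℤ (((c : K) + e * ω) * θ) :=
      ((isIntegral_algebraMap (R := ℤ) (x := c)).add
        ((isIntegral_algebraMap (R := ℤ) (x := e)).mul hω)).mul hθ
    have := hα.sub hyθ
    rwa [add_sub_cancel_right] at this
  have hw : algebraMap ℚ K p' + algebraMap ℚ K q' * ω = algebraMap ℚ K (p' + q' * m / 2)
      + algebraMap ℚ K (q' / 2) * (2 * ω - ((z : K) ^ 2 - 2)) := by
    simp only [map_add, map_mul, map_div₀, map_ofNat, hmK]; ring
  rw [hw] at hx
  obtain ⟨h3, h4⟩ := h.trace_norm_integral htop hx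
  obtain ⟨a, b, ha, hb⟩ := odd_quadratic_integral (m := z ^ 2 - 2) rfl hmo hd h3
    (by push_cast; exact h4)
  refine ⟨a, b, c, e, ?_⟩
  have ha' : p' = a := by rw [← ha, hmdef]; ring
  have hb' : q' = b := by rw [← hb]; ring
  rw [ha', hb', map_intCast, map_intCast]

/-- For even `z` four times every algebraic integer lies in `ℤ[ω] + ℤ[ω] (θ - z / 4)`. -/
theorem QuarticData.exists_int_coords_of_even (h : QuarticData z θ ω η) (htop : ℚ⟮θ⟯ = ⊤)
    {j : ℤ} (hz : z = 2 * j) (hS : SquarefreeConditions z) (hθ : IsIntegral ℤ (θ - z / 4))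
    (hω : IsIntegral ℤ ω) {α : K} (hα : IsIntegral ℤ α) :
    ∃ a b c e : ℤ, 4 * α = a + b * ω + (c + e * ω) * (θ - z / 4) := by
  have : CharZero K := algebraRat.charZero K
  set m' : ℤ := 2 * j ^ 2 - 1 with hm'def
  set D : ℤ := m' ^ 2 + 1 with hDdef
  have hzm : z ^ 2 - 2 = 2 * m' := by rw [hz, hm'def]; ring
  have hm : Squarefree m' := (hzm ▸ hS.1 : Squarefree (2 * m')).of_mul_right
  have hmo : Odd m' := ⟨j ^ 2 - 1, by rw [hm'def]; ring⟩
  have hd : Squarefree D := by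
    have := hS.2.1 ⟨j, by rw [hz]; ring⟩
    rwa [show z ^ 4 - 4 * z ^ 2 + 8 = 4 * D by rw [hz, hDdef, hm'def]; ring,
      Int.mul_ediv_cancel_left _ (by norm_num)] at this
  obtain ⟨p, q, r, s, rfl⟩ := h.exists_rat_coords htop α
  have hmQ : ((2 : ℚ) * m') = (z : ℚ) ^ 2 - 2 := by exact_mod_cast hzm.symm
  have hmK : ((2 : K) * m') = (z : K) ^ 2 - 2 := by exact_mod_cast hzm.symm
  have hDQ : (4 : ℚ) * D = (2 * m') ^ 2 + 4 := by rw [hDdef]; push_cast; ring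
  obtain ⟨h1, h2⟩ := h.disc_coords_integral htop hα (2 * m') (4 * D) hmQ hDQ _ _ rfl rfl
  obtain ⟨R, S, hR, hS'⟩ := even_coeff_integral hDdef hm hd h1 h2
  have hs : algebraMap ℚ K s = S / 8 := by
    have : s = S / 8 := by rw [← hS']; ring
    rw [this]; simp
  have hr : algebraMap ℚ K r = (R - S * m') / 8 := by
    have : r = (R - S * m') / 8 := by rw [← hR, ← hS']; ring
    rw [this]; simp
  set c : ℤ := R - S * m' with hc
  -- `p' + q' ω` is `4 α - (c + S ω) (θ - z / 4)`.
  set p' : ℚ := 4 * p - z * (- c * (2 * m') + 2 * S) / 4 with hp'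
  set q' : ℚ := 4 * q - z * (2 * c - S * (2 * m') + 2 * S * (2 * m')) / 4 with hq'
  have key : 4 * (algebraMap ℚ K p + algebraMap ℚ K q * ω
      + (algebraMap ℚ K r + algebraMap ℚ K s * ω) * η)
      = algebraMap ℚ K p' + algebraMap ℚ K q' * ω + (c + S * ω) * (θ - z / 4) := by
    have hη : η = 2 * (θ - z / 4) - z * (2 * ω - 2 * m') / 2 := by
      linear_combination -h.four_theta / 2 - (z : K) / 2 * hmK
    rw [hη, hr, hs, hp', hq', hc]
    simp only [map_sub, map_mul, map_add, map_div₀, map_ofNat, map_intCast, map_neg, Int.cast_sub,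
      Int.cast_mul]
    linear_combination (-(S : K) * z / 2) * h.sq_omega + ((S : K) * z / 2 * ω) * hmK
  rw [key]
  have hα4 : IsIntegral ℤ (4 * (algebraMap ℚ K p + algebraMap ℚ K q * ω
      + (algebraMap ℚ K r + algebraMap ℚ K s * ω) * η)) := by
    have h4 := isIntegral_algebraMap (R := ℤ) (A := K) (x := 4)
    rw [map_ofNat] at h4
    exact h4.mul hα
  rw [key] at hα4
  have hx : IsIntegral ℤ (algebraMap ℚ K p' + algebraMap ℚ K q' * ω) := by
    have hyθ : IsIntegral ℤ (((c : K) + S * ω) * (θ - z / 4)) :=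
      ((isIntegral_algebraMap (R := ℤ) (x := c)).add
        ((isIntegral_algebraMap (R := ℤ) (x := S)).mul hω)).mul hθ
    have := hα4.sub hyθ
    rwa [add_sub_cancel_right] at this
  have hw : algebraMap ℚ K p' + algebraMap ℚ K q' * ω = algebraMap ℚ K (p' + q' * m')
      + algebraMap ℚ K (q' / 2) * (2 * ω - ((z : K) ^ 2 - 2)) := by
    rw [← hmK]
    simp only [map_add, map_mul, map_div₀, map_ofNat, map_intCast]; ring
  rw [hw] at hx
  obtain ⟨h3, h4⟩ := h.trace_norm_integral htop hx
  obtain ⟨a, b, ha, hb⟩ := even_quadratic_integral hDdef hmo hd h3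
    (by rw [hDQ, hmQ]; exact h4)
  refine ⟨a, b, c, S, ?_⟩
  have ha' : p' = a := by rw [← ha]; ring
  have hb' : q' = b := by rw [← hb]; ring
  rw [ha', hb', map_intCast, map_intCast]

end

/-! ### Integral models of the quartic -/

/-- The integrality statements for odd `z` only involve `z` and `t = (z ^ 2 - 1) / 8`. -/
theorem exists_sq_eq_of_odd {z : ℤ} (hz : Odd z) : ∃ t, z ^ 2 = 1 + 8 * t := by
  obtain ⟨k, rfl⟩ := hz
  obtain ⟨t, ht⟩ := Int.even_mul_succ_self k
  exact ⟨t, by linear_combination 4 * ht⟩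

theorem hasIntegerCoeffs_quarticF_of_odd {z : ℤ} (hz : Odd z) : HasIntegerCoeffs (quarticF z) := by
  obtain ⟨t, ht⟩ := exists_sq_eq_of_odd hz
  refine ⟨X ^ 4 - C z * X ^ 3 - C (-1 + 14 * t - 56 * t ^ 2 + 192 * t ^ 3) * X ^ 2
    - C (z * (1 - 20 * t + 108 * t ^ 2 - 352 * t ^ 3 + 512 * t ^ 4)) * X
    - C (-1 + 10 * t - 20 * t ^ 2 - 120 * t ^ 3 + 944 * t ^ 4 - 2816 * t ^ 5 + 3072 * t ^ 6), ?_⟩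
  have hq : (z : ℚ) ^ 2 = 1 + 8 * t := by exact_mod_cast ht
  have h3 : (z : ℚ) ^ 3 = (1 + 8 * t) * z := by rw [← hq]; ring
  have h4 : (z : ℚ) ^ 4 = (1 + 8 * t) ^ 2 := by rw [← hq]; ring
  have h5 : (z : ℚ) ^ 5 = (1 + 8 * t) ^ 2 * z := by rw [← hq]; ring
  have h6 : (z : ℚ) ^ 6 = (1 + 8 * t) ^ 3 := by rw [← hq]; ring
  have h7 : (z : ℚ) ^ 7 = (1 + 8 * t) ^ 3 * z := by rw [← hq]; ring
  have h8 : (z : ℚ) ^ 8 = (1 + 8 * t) ^ 4 := by rw [← hq]; ring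
  have h9 : (z : ℚ) ^ 9 = (1 + 8 * t) ^ 4 * z := by rw [← hq]; ring
  have h10 : (z : ℚ) ^ 10 = (1 + 8 * t) ^ 5 := by rw [← hq]; ring
  have h12 : (z : ℚ) ^ 12 = (1 + 8 * t) ^ 6 := by rw [← hq]; ring
  simp only [Polynomial.map_sub, Polynomial.map_mul, Polynomial.map_pow, map_X, map_C]
  rw [quarticF]
  congr 1
  · congr 1
    · congr 1
      congr 2
      rw [hq, h4, h6, eq_intCast]; push_cast; ring
    · congr 2
      rw [h3, h5, h7, h9, eq_intCast]; push_cast; ring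
  · congr 1
    rw [hq, h4, h6, h8, h10, h12, eq_intCast]; push_cast; ring

/-- The depressed form of `f_z` for `z = 2 j`, that is `f_z(X + z / 4)`, which has integer
coefficients. -/
noncomputable def evenQuartic (j : ℤ) : ℤ[X] :=
  X ^ 4 - C (4 * (3 * j ^ 2 - 1) * (2 * j ^ 4 - 2 * j ^ 2 + 1)) * X ^ 2
    - C (8 * j * (2 * j ^ 2 - 1) ^ 2 * (2 * j ^ 4 - 2 * j ^ 2 + 1)) * X
    + C (4 * (2 * j ^ 4 - 2 * j ^ 2 + 1) ^ 2 * (1 - j ^ 2) ^ 2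
      - 2 * (2 * j ^ 4 - 2 * j ^ 2 + 1) * (2 * j ^ 2 - 1) ^ 4)

theorem evenQuartic_comp {z j : ℤ} (hz : z = 2 * j) :
    ((evenQuartic j).map (Int.castRingHom ℚ)).comp (X - C ((z : ℚ) / 4)) = quarticF z := by
  refine Polynomial.funext fun x => ?_
  have hx := aeval_quarticF z x
  rw [coe_aeval_eq_eval] at hx
  rw [hx, hz, evenQuartic]
  simp only [Polynomial.map_sub, Polynomial.map_add, Polynomial.map_mul, Polynomial.map_pow, map_X,
    map_C, eval_comp, eval_sub, eval_add, eval_mul, eval_pow, eval_X, eval_C]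
  simp only [eq_intCast]
  push_cast
  ring

theorem evenQuartic_monic (j : ℤ) : (evenQuartic j).Monic := by
  unfold evenQuartic
  monicity!

theorem evenQuartic_natDegree (j : ℤ) : (evenQuartic j).natDegree = 4 := by
  unfold evenQuartic
  compute_degree!

theorem evenQuartic_isEisensteinAt (j : ℤ) :
    (evenQuartic j).IsEisensteinAt (Submodule.span ℤ {2}) := by
  refine ⟨?_, ?_, ?_⟩
  · rw [(evenQuartic_monic j).leadingCoeff, Ideal.submodule_span_eq, Ideal.mem_span_singleton]
    decide
  · intro n hn
    rw [evenQuartic_natDegree] at hn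
    rw [Ideal.submodule_span_eq, Ideal.mem_span_singleton, evenQuartic]
    interval_cases n
    · simp only [coeff_sub, coeff_add, coeff_C_mul, coeff_X_pow, coeff_X, coeff_C]
      norm_num
      exact ⟨2 * (2 * j ^ 4 - 2 * j ^ 2 + 1) ^ 2 * (1 - j ^ 2) ^ 2
        - (2 * j ^ 4 - 2 * j ^ 2 + 1) * (2 * j ^ 2 - 1) ^ 4, by ring⟩
    · simp only [coeff_sub, coeff_add, coeff_C_mul, coeff_X_pow, coeff_X, coeff_C]
      norm_num
      exact ⟨4 * j * (2 * j ^ 2 - 1) ^ 2 * (2 * j ^ 4 - 2 * j ^ 2 + 1), by ring⟩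
    · simp only [coeff_sub, coeff_add, coeff_C_mul, coeff_X_pow, coeff_X, coeff_C]
      norm_num
      exact ⟨2 * (3 * j ^ 2 - 1) * (2 * j ^ 4 - 2 * j ^ 2 + 1), by ring⟩
    · simp only [coeff_sub, coeff_add, coeff_C_mul, coeff_X_pow, coeff_X, coeff_C]
      norm_num
  · rw [Ideal.submodule_span_eq, Ideal.span_singleton_pow, Ideal.mem_span_singleton, evenQuartic]
    rintro ⟨k, hk⟩
    have h0 : 4 * (2 * j ^ 4 - 2 * j ^ 2 + 1) ^ 2 * (1 - j ^ 2) ^ 2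
      - 2 * (2 * j ^ 4 - 2 * j ^ 2 + 1) * (2 * j ^ 2 - 1) ^ 4 = 2 ^ 2 * k := by
      rw [← hk]
      simp only [coeff_sub, coeff_add, coeff_C_mul, coeff_X_pow, coeff_X, coeff_C]
      norm_num
    have hodd : Odd ((2 * j ^ 4 - 2 * j ^ 2 + 1) * (2 * j ^ 2 - 1) ^ 4) :=
      Odd.mul ⟨j ^ 4 - j ^ 2, by ring⟩ (Odd.pow ⟨j ^ 2 - 1, by ring⟩)
    obtain ⟨u, hu⟩ := hodd
    have : 2 * ((2 * j ^ 4 - 2 * j ^ 2 + 1) ^ 2 * (1 - j ^ 2) ^ 2) - (2 * u + 1) = 2 * k := by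
      rw [← hu]; linarith
    omega

/-! ### Algebraic integers as polynomials in a root -/

section
variable {K : Type*} [Field K]

theorem isPowerIntegralBasis_of_adjoin [CharZero K] {θ : K} {n : ℕ} (hθ : IsIntegral ℤ θ)
    (hdeg : (minpoly ℤ θ).natDegree = n)
    (h : ∀ α : K, IsIntegral ℤ α → α ∈ Algebra.adjoin ℤ {θ}) : IsPowerIntegralBasis K n θ := by
  have heq : Algebra.adjoin ℤ {θ} = integralClosure ℤ K :=
    le_antisymm (adjoin_le_integralClosure hθ) fun α hα => h α hα
  let pb := Algebra.adjoin.powerBasis' hθ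
  have hdim : pb.dim = n := hdeg
  let e : Algebra.adjoin ℤ {θ} ≃ₐ[ℤ] NumberField.RingOfIntegers K := Subalgebra.equivOfEq _ _ heq
  refine ⟨(pb.basis.reindex (finCongr hdim)).map e.toLinearEquiv, fun i => ?_⟩
  have hgen : ((pb.gen : Algebra.adjoin ℤ {θ}) : K) = θ := by
    simp [pb, Algebra.adjoin.powerBasis'_gen]
  rw [Module.Basis.map_apply, Module.Basis.reindex_apply, PowerBasis.basis_eq_pow]
  change ((pb.gen ^ _ : Algebra.adjoin ℤ {θ}) : K) = _
  rw [SubmonoidClass.coe_pow, hgen]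
  rfl

variable [Algebra ℚ K] {z : ℤ} {θ ω η : K}

theorem natDegree_minpoly_int {x : K} {n : ℕ} (hx : IsIntegral ℤ x)
    (h : (minpoly ℚ x).natDegree = n) : (minpoly ℤ x).natDegree = n := by
  rw [minpoly.isIntegrallyClosed_eq_field_fractions' ℚ hx,
    (minpoly.monic hx).natDegree_map] at h
  exact h

theorem isIntegral_of_hasIntegerCoeffs {p : ℚ[X]} (hp : p.Monic) (h : HasIntegerCoeffs p) {x : K}
    (hx : aeval x p = 0) : IsIntegral ℤ x := by
  obtain ⟨q, rfl⟩ := h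
  refine ⟨q, monic_of_injective (Int.castRingHom ℚ).injective_int hp, ?_⟩
  rwa [← algebraMap_int_eq, aeval_map_algebraMap] at hx

theorem QuarticData.mem_adjoin_of_odd (h : QuarticData z θ ω η) (htop : ℚ⟮θ⟯ = ⊤)
    (hz : Odd z) (hS : SquarefreeConditions z) {α : K} (hα : IsIntegral ℤ α) :
    α ∈ Algebra.adjoin ℤ {θ} := by
  have : CharZero K := algebraRat.charZero K
  have hθ : IsIntegral ℤ θ := isIntegral_of_hasIntegerCoeffs (quarticF_monic z)
    (hasIntegerCoeffs_quarticF_of_odd hz) h.root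
  have hθm : θ ∈ Algebra.adjoin ℤ {θ} := Algebra.self_mem_adjoin_singleton ℤ θ
  have hint (n : ℤ) : (n : K) ∈ Algebra.adjoin ℤ {θ} := intCast_mem _ n
  have hωm : ω ∈ Algebra.adjoin ℤ {θ} := by
    obtain ⟨t, ht⟩ := exists_sq_eq_of_odd hz
    have hq : (z : K) ^ 2 = 1 + 8 * t := by exact_mod_cast ht
    -- `quadUnit` expanded in powers of `θ`.
    have hω : ω = ((-z : ℤ) : K) * θ ^ 3 + ((1 + 2 * t + 16 * t ^ 2 : ℤ) : K) * θ ^ 2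
        + ((z * (12 * t - 44 * t ^ 2 + 160 * t ^ 3) : ℤ) : K) * θ
        + ((-8 * t + 20 * t ^ 2 + 56 * t ^ 3 - 640 * t ^ 4 + 1536 * t ^ 5 : ℤ) : K) := by
      rw [← h.quadUnit_eq, quadUnit, hq]
      push_cast
      linear_combination (3 / 4 * θ ^ 2 - 3 / 16 * z * θ
        + (z ^ 2 + 1 + 8 * t) / 64 - 1 / 16 - 25 / 8 * t + 10 * t ^ 2 - 40 * t ^ 3) * hq
    rw [hω]
    exact add_mem (add_mem (add_mem (mul_mem (hint _) (pow_mem hθm 3))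
      (mul_mem (hint _) (pow_mem hθm 2))) (mul_mem (hint _) hθm)) (hint _)
  have hω : IsIntegral ℤ ω := adjoin_le_integralClosure hθ hωm
  obtain ⟨a, b, c, e, rfl⟩ := h.exists_int_coords_of_odd htop hz hS hθ hω hα
  exact add_mem (add_mem (hint a) (mul_mem (hint b) hωm))
    (mul_mem (add_mem (hint c) (mul_mem (hint e) hωm)) hθm)

theorem adjoin_sub_rat_eq_top (htop : ℚ⟮θ⟯ = ⊤) (q : ℚ) : ℚ⟮θ - algebraMap ℚ K q⟯ = ⊤ := by
  rw [eq_top_iff, ← htop, adjoin_simple_le_iff]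
  have h1 := mem_adjoin_simple_self ℚ (θ - algebraMap ℚ K q)
  have h2 := IntermediateField.algebraMap_mem ℚ⟮θ - algebraMap ℚ K q⟯ q
  simpa using add_mem h1 h2

/-- For even `z` the element `θ - z / 4` is integral, with minimal polynomial `evenQuartic`. -/
theorem minpoly_sub_quarter {j : ℤ} (hz : z = 2 * j) (h : aeval θ (quarticF z) = 0) :
    IsIntegral ℤ (θ - z / 4) ∧ minpoly ℤ (θ - z / 4) = evenQuartic j := by
  have : CharZero K := algebraRat.charZero K
  have hroot : aeval (θ - z / 4) (evenQuartic j) = 0 := by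
    rw [← evenQuartic_comp hz, aeval_comp] at h
    simpa [aeval_map_algebraMap, ← algebraMap_int_eq] using h
  have hint : IsIntegral ℤ (θ - z / 4) := ⟨_, evenQuartic_monic j, hroot⟩
  refine ⟨hint, ?_⟩
  have hq : (minpoly ℚ (θ - z / 4)).natDegree = 4 := by
    have e : θ - (z : K) / 4 = θ - algebraMap ℚ K ((z : ℚ) / 4) := by simp
    rw [e, minpoly.sub_algebraMap, natDegree_comp, minpoly_eq_quarticF h, quarticF_natDegree,
      natDegree_X_add_C]
  refine (eq_of_monic_of_dvd_of_natDegree_le (minpoly.monic hint) (evenQuartic_monic j)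
    (minpoly.isIntegrallyClosed_dvd hint hroot) ?_).symm
  rw [natDegree_minpoly_int hint hq, evenQuartic_natDegree]

/-- The factor `4` in `QuarticData.exists_int_coords_of_even` is removed by the Eisenstein property
of the minimal polynomial of `θ - z / 4` at `2`. -/
theorem QuarticData.mem_adjoin_of_even (h : QuarticData z θ ω η) (htop : ℚ⟮θ⟯ = ⊤)
    {j : ℤ} (hz : z = 2 * j) (hS : SquarefreeConditions z) {α : K} (hα : IsIntegral ℤ α) :
    α ∈ Algebra.adjoin ℤ {θ - (z : K) / 4} := by
  have : CharZero K := algebraRat.charZero K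
  obtain ⟨hφ, hmin⟩ := minpoly_sub_quarter hz h.root
  set φ := θ - (z : K) / 4 with hφdef
  have hφm : φ ∈ Algebra.adjoin ℤ {φ} := Algebra.self_mem_adjoin_singleton ℤ φ
  have hint (n : ℤ) : (n : K) ∈ Algebra.adjoin ℤ {φ} := intCast_mem _ n
  have hωm : ω ∈ Algebra.adjoin ℤ {φ} := by
    have hω : ω = ((-2 * j : ℤ) : K) * φ ^ 3 + (((2 * j ^ 2 - 1) ^ 2 : ℤ) : K) * φ ^ 2
        + ((4 * j * (2 * j ^ 4 - 2 * j ^ 2 + 1) * (5 * j ^ 2 - 1) : ℤ) : K) * φ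
        + ((2 * (2 * j ^ 2 - 1) ^ 2 * (2 * j ^ 4 - 2 * j ^ 2 + 1) * (3 * j ^ 2 + 1)
          + (2 * j ^ 2 - 1) : ℤ) : K) := by
      rw [← h.quadUnit_eq, quadUnit, ← hφdef, hz]
      push_cast
      field_simp
      ring
    rw [hω]
    exact add_mem (add_mem (add_mem (mul_mem (hint _) (pow_mem hφm 3))
      (mul_mem (hint _) (pow_mem hφm 2))) (mul_mem (hint _) hφm)) (hint _)
  have hω : IsIntegral ℤ ω := adjoin_le_integralClosure hφ hωm
  obtain ⟨a, b, c, e, h4⟩ := h.exists_int_coords_of_even htop hz hS hφ hω hα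
  have hmem : (2 : ℤ) ^ 2 • α ∈ Algebra.adjoin ℤ {φ} := by
    have h4' : (2 : ℤ) ^ 2 • α = a + b * ω + (c + e * ω) * φ := by
      rw [← h4, zsmul_eq_mul]; norm_num
    rw [h4']
    exact add_mem (add_mem (hint a) (mul_mem (hint b) hωm))
      (mul_mem (add_mem (hint c) (mul_mem (hint e) hωm)) hφm)
  have hφQ : IsIntegral ℚ φ := hφ.tower_top
  have htopφ : ℚ⟮φ⟯ = ⊤ := by
    have := adjoin_sub_rat_eq_top htop ((z : ℚ) / 4)
    simpa [hφdef] using this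
  have htop' : Algebra.adjoin ℚ {φ} = ⊤ := by
    rw [← adjoin_simple_toSubalgebra_of_isAlgebraic hφQ.isAlgebraic, htopφ, top_toSubalgebra]
  let pb := PowerBasis.ofAdjoinEqTop hφQ htop'
  have hgen : pb.gen = φ := PowerBasis.ofAdjoinEqTop_gen hφQ htop'
  have := mem_adjoin_of_smul_prime_pow_smul_of_minpoly_isEisensteinAt (B := pb) (R := ℤ)
    Int.prime_two (hgen ▸ hφ) hα (hgen ▸ hmem)
    (by rw [hgen, hmin]; exact evenQuartic_isEisensteinAt j)
  rwa [hgen] at this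

theorem adjoin_singleton_add_intCast {K : Type*} [Field K] (x : K) (n : ℤ) :
    Algebra.adjoin ℤ {x + n} = Algebra.adjoin ℤ {x} := by
  refine le_antisymm (Algebra.adjoin_singleton_le ?_) (Algebra.adjoin_singleton_le ?_)
  · exact add_mem (Algebra.self_mem_adjoin_singleton ℤ x) (intCast_mem _ n)
  · have := sub_mem (Algebra.self_mem_adjoin_singleton ℤ (x + n))
      (intCast_mem (Algebra.adjoin ℤ {x + (n : K)}) n)
    simpa using this

end

/-! ### Power integral bases -/

section
variable {K : Type*} [Field K] [Algebra ℚ K] {z : ℤ} {θ : K}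

theorem isPowerIntegralBasis_of_odd [CharZero K] (h : aeval θ (quarticF z) = 0) (htop : ℚ⟮θ⟯ = ⊤)
    (hz : Odd z) (hS : SquarefreeConditions z) : IsPowerIntegralBasis K 4 θ := by
  have hθ : IsIntegral ℤ θ := isIntegral_of_hasIntegerCoeffs (quarticF_monic z)
    (hasIntegerCoeffs_quarticF_of_odd hz) h
  exact isPowerIntegralBasis_of_adjoin hθ
    (natDegree_minpoly_int hθ (by rw [minpoly_eq_quarticF h, quarticF_natDegree]))
    fun α hα => (QuarticData.of_root h).mem_adjoin_of_odd htop hz hS hα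

theorem isPowerIntegralBasis_of_even [CharZero K] (h : aeval θ (quarticF z) = 0) (htop : ℚ⟮θ⟯ = ⊤)
    {j : ℤ} (hz : z = 2 * j) (hS : SquarefreeConditions z) (n : ℤ) :
    IsPowerIntegralBasis K 4 (θ - z / 4 + n) := by
  obtain ⟨hφ, hmin⟩ := minpoly_sub_quarter hz h
  have e : minpoly ℚ (θ - z / 4 + n) = (minpoly ℚ (θ - z / 4)).comp (X - C (n : ℚ)) := by
    rw [← minpoly.add_algebraMap, map_intCast]
  have hint : IsIntegral ℤ (θ - z / 4 + n) :=
    hφ.add (isIntegral_algebraMap (R := ℤ) (A := K) (x := n))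
  refine isPowerIntegralBasis_of_adjoin hint (natDegree_minpoly_int hint ?_) fun α hα => ?_
  · rw [e, natDegree_comp, natDegree_X_sub_C, mul_one,
      minpoly.isIntegrallyClosed_eq_field_fractions' ℚ hφ, (minpoly.monic hφ).natDegree_map, hmin,
      evenQuartic_natDegree]
  · rw [adjoin_singleton_add_intCast]
    exact (QuarticData.of_root h).mem_adjoin_of_even htop hz hS hα

theorem isPowerIntegralBasis_of_not_modEq_two [CharZero K] (h : aeval θ (quarticF z) = 0)
    (htop : ℚ⟮θ⟯ = ⊤) (hz : ¬ z ≡ 2 [ZMOD 4]) (hS : SquarefreeConditions z) :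
    IsPowerIntegralBasis K 4 θ := by
  rcases Int.even_or_odd' z with ⟨j, hj | hj⟩
  · obtain ⟨k, hk⟩ : ∃ k, z = 4 * k := ⟨z / 4, by
      rw [Int.ModEq] at hz; omega⟩
    have := isPowerIntegralBasis_of_even h htop hj hS k
    rwa [hk, show θ - ((4 * k : ℤ) : K) / 4 + k = θ by push_cast; field_simp; ring] at this
  · exact isPowerIntegralBasis_of_odd h htop ⟨j, hj⟩ hS

theorem isPowerIntegralBasis_of_modEq_two [CharZero K] (h : aeval θ (quarticF z) = 0)
    (htop : ℚ⟮θ⟯ = ⊤) (hz : z ≡ 2 [ZMOD 4]) (hS : SquarefreeConditions z) :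
    IsPowerIntegralBasis K 4 (θ + 1 / 2) := by
  obtain ⟨k, hk⟩ : ∃ k, z = 4 * k + 2 := ⟨z / 4, by
    rw [Int.ModEq] at hz; omega⟩
  have := isPowerIntegralBasis_of_even h htop (j := 2 * k + 1) (by rw [hk]; ring) hS (k + 1)
  rwa [hk, show θ - ((4 * k + 2 : ℤ) : K) / 4 + ((k + 1 : ℤ) : K) = θ + 1 / 2 by
    push_cast; field_simp; ring] at this

theorem isMonogenicField_of_root [CharZero K] (h : aeval θ (quarticF z) = 0)
    (htop : ℚ⟮θ⟯ = ⊤) (hS : SquarefreeConditions z) : IsMonogenicField K := by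
  obtain rfl : ‹Algebra ℚ K› = DivisionRing.toRatAlgebra := Subsingleton.elim _ _
  have h4 := finrank_eq_four h htop
  have : FiniteDimensional ℚ K := Module.finite_of_finrank_pos (by rw [h4]; norm_num)
  refine ⟨{}, ?_⟩
  rw [h4]
  by_cases hz : z ≡ 2 [ZMOD 4]
  · exact ⟨_, isPowerIntegralBasis_of_modEq_two h htop hz hS⟩
  · exact ⟨_, isPowerIntegralBasis_of_not_modEq_two h htop hz hS⟩

theorem isPowerIntegralBasis_of_comp_root [CharZero K] {y : K}
    (h : aeval y ((quarticF z).comp (X - C (1 / 2))) = 0) (htop : ℚ⟮y⟯ = ⊤)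
    (hz : z ≡ 2 [ZMOD 4]) (hS : SquarefreeConditions z) : IsPowerIntegralBasis K 4 y := by
  rw [aeval_comp, map_sub, aeval_X, aeval_C] at h
  have := isPowerIntegralBasis_of_modEq_two h (adjoin_sub_rat_eq_top htop (1 / 2)) hz hS
  rwa [show y - algebraMap ℚ K (1 / 2) + 1 / 2 = y by simp] at this

end

theorem adjoinSimple_gen_eq_top {F E : Type*} [Field F] [Field E] [Algebra F E] (x : E) :
    F⟮AdjoinSimple.gen F x⟯ = ⊤ := by
  apply IntermediateField.map_injective F⟮x⟯.val
  rw [adjoin_map, Set.image_singleton, ← AlgHom.fieldRange_eq_map, fieldRange_val]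
  rfl

theorem aeval_gen_eq_zero {F E : Type*} [Field F] [Field E] [Algebra F E] {p : F[X]} {x : E}
    (h : aeval x p = 0) : aeval (AdjoinSimple.gen F x) p = 0 := by
  apply (algebraMap F⟮x⟯ E).injective
  rw [map_zero, ← aeval_algebraMap_apply, AdjoinSimple.algebraMap_gen, h]

theorem hasIntegerCoeffs_of_not_modEq_two {z : ℤ} (hz : ¬ z ≡ 2 [ZMOD 4]) :
    HasIntegerCoeffs (quarticF z) := by
  rcases Int.even_or_odd' z with ⟨j, hj | hj⟩
  · obtain ⟨k, hk⟩ : ∃ k, z = 4 * k := ⟨z / 4, by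
      rw [Int.ModEq] at hz; omega⟩
    refine ⟨(evenQuartic j).comp (X - C k), ?_⟩
    rw [← evenQuartic_comp hj, Polynomial.map_comp, Polynomial.map_sub, map_X, map_C, hk]
    congr 3
    simp
  · exact hasIntegerCoeffs_quarticF_of_odd ⟨j, hj⟩

theorem hasIntegerCoeffs_comp_of_modEq_two {z : ℤ} (hz : z ≡ 2 [ZMOD 4]) :
    HasIntegerCoeffs ((quarticF z).comp (X - C (1 / 2))) := by
  obtain ⟨k, hk⟩ : ∃ k, z = 4 * k + 2 := ⟨z / 4, by
    rw [Int.ModEq] at hz; omega⟩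
  refine ⟨(evenQuartic (2 * k + 1)).comp (X - C (k + 1)), ?_⟩
  rw [← evenQuartic_comp (z := z) (j := 2 * k + 1) (by rw [hk]; ring), comp_assoc,
    Polynomial.map_comp]
  congr 1
  simp only [Polynomial.map_sub, map_X, map_C, sub_comp, X_comp, C_comp]
  rw [sub_sub, ← C_add, hk, eq_intCast]
  congr 2
  push_cast
  ring

theorem aeval_add_half_comp {p : ℚ[X]} {x : ℂ} (h : aeval x p = 0) :
    aeval (x + 1 / 2) (p.comp (X - C (1 / 2))) = 0 := by
  rw [aeval_comp]
  convert h using 2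
  simp

theorem theorem1 (z : ℤ) :
    -- irreducibility, Galois group, real roots
    (Irreducible (quarticF z) ∧
      Nonempty ((quarticF z).Gal ≃* Multiplicative (ZMod 4)) ∧
      (2 ≤ |z| → ∀ ϑ : ℂ, aeval ϑ (quarticF z) = 0 → ϑ.im = 0)) ∧
    -- monogenicity
    (SquarefreeConditions z →
      ∀ ϑ : ℂ, aeval ϑ (quarticF z) = 0 → IsMonogenicField ℚ⟮ϑ⟯) ∧
    -- explicit integral basis when z is not 2 mod 4
    (¬ z ≡ 2 [ZMOD 4] →
      HasIntegerCoeffs (quarticF z) ∧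
      (SquarefreeConditions z →
        ∀ ϑ : ℂ, aeval ϑ (quarticF z) = 0 →
          IsPowerIntegralBasis ℚ⟮ϑ⟯ 4 (AdjoinSimple.gen ℚ ϑ))) ∧
    -- explicit integral basis when z is 2 mod 4
    (z ≡ 2 [ZMOD 4] →
      HasIntegerCoeffs ((quarticF z).comp (X - C (1 / 2))) ∧
      (∀ ϑ : ℂ, aeval ϑ (quarticF z) = 0 →
        aeval (ϑ + 1 / 2) ((quarticF z).comp (X - C (1 / 2))) = 0) ∧
      (SquarefreeConditions z →
        ∀ ϑ : ℂ, aeval ϑ (quarticF z) = 0 →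
          IsPowerIntegralBasis ℚ⟮ϑ + 1 / 2⟯ 4 (AdjoinSimple.gen ℚ (ϑ + 1 / 2)))) := by
  refine ⟨⟨quarticF_irreducible z, nonempty_gal_mulEquiv z, fun hz ϑ => im_eq_zero_of_root hz⟩,
    fun hS ϑ h => ?_, fun hz => ⟨hasIntegerCoeffs_of_not_modEq_two hz, fun hS ϑ h => ?_⟩,
    fun hz => ⟨hasIntegerCoeffs_comp_of_modEq_two hz, fun ϑ => aeval_add_half_comp,
      fun hS ϑ h => ?_⟩⟩
  · exact @isMonogenicField_of_root _ _ ℚ⟮ϑ⟯.algebra' _ _ _ (aeval_gen_eq_zero h)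
      (adjoinSimple_gen_eq_top ϑ) hS
  · exact @isPowerIntegralBasis_of_not_modEq_two _ _ ℚ⟮ϑ⟯.algebra' _ _ _ (aeval_gen_eq_zero h)
      (adjoinSimple_gen_eq_top ϑ) hz hS
  · exact @isPowerIntegralBasis_of_comp_root _ _ ℚ⟮ϑ + 1 / 2⟯.algebra' _ _ _
      (aeval_gen_eq_zero (aeval_add_half_comp h)) (adjoinSimple_gen_eq_top _) hz hS
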